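/- Let $G$ be a set of cardinality $2^{\omega}$, and let $\mathbb R^G$ carry the product topology. There exists a Hausdorff real locally convex space $E$ with the following properties: (i) $E$ is a Baire space (the intersection of any sequence of open dense subsets of $E$ is dense in $E$); (ii) $E$ is feral, that is, every bounded subset of $E$ is contained in a finite-dimensional subspace; moreover $E$ is quasi-complete (every closed bounded subset of $E$ is complete), and $E$ has the property $(K)$: for every sequence $(x_n)$ converging to $0$ in $E$, each subsequence of $(x_n)$ has a further subsequence $(y_n)$ such that the series $\sum_n y_n$ converges in $E$; (iii) $E$ is not $\kappa$-Fréchet–Urysohn; (iv) the completion $\widehat E$ of $E$ is isomorphic, as a topological vector space, to $\mathbb R^G$, and $\widehat E$ is $\kappa$-Fréchet–Urysohn. Here a Tychonoff space $X$ is called $\kappa$-Fréchet–Urysohn if for every open set $U\subseteq X$ and every point $x\in\overline U$ there is a sequence of points of $U$ that converges to $x$. In particular, a quasi-complete Baire locally convex space need not be $\kappa$-Fréchet–Urysohn. -/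

import Mathlib

open Filter Topology

universe u

/-- The `κ`-Fréchet–Urysohn property: every point of the closure of an open set `U` is the limit of
a sequence of points of `U`. (It is used for Hausdorff topological vector spaces only; these are
automatically Tychonoff.) -/
def IsKappaFrechetUrysohn (X : Type*) [TopologicalSpace X] : Prop :=
  ∀ U : Set X, IsOpen U → ∀ x ∈ closure U,
    ∃ u : ℕ → X, (∀ n, u n ∈ U) ∧ Tendsto u atTop (𝓝 x)

/-- A topological vector space is feral if every (von Neumann) bounded subset is
finite-dimensional, that is, spans a finite-dimensional subspace. -/
def IsFeral (E : Type*) [AddCommGroup E] [Module ℝ E] [TopologicalSpace E] : Prop :=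
  ∀ B : Set E, Bornology.IsVonNBounded ℝ B → FiniteDimensional ℝ (Submodule.span ℝ B)

/-- A null sequence `x` is a `K`-sequence if every subsequence of it has a further subsequence
whose series converges (in the sense of partial sums). -/
def IsKSequence {E : Type*} [AddCommGroup E] [TopologicalSpace E] (x : ℕ → E) : Prop :=
  Tendsto x atTop (𝓝 0) ∧
    ∀ φ : ℕ → ℕ, StrictMono φ → ∃ ψ : ℕ → ℕ, StrictMono ψ ∧
      ∃ s : E, Tendsto (fun N => ∑ i ∈ Finset.range N, x (φ (ψ i))) atTop (𝓝 s)

/-- Property `(K)`: every null sequence is a `K`-sequence. -/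
def HasPropertyK (E : Type*) [AddCommGroup E] [TopologicalSpace E] : Prop :=
  ∀ x : ℕ → E, Tendsto x atTop (𝓝 0) → IsKSequence x

/-- Scalar multiplications of a topological vector space are uniformly continuous. This is what
puts the vector space structure on the completion. -/
instance uniformContinuousConstSMul_of_tvs (E : Type*) [AddCommGroup E] [Module ℝ E]
    [UniformSpace E] [IsUniformAddGroup E] [ContinuousSMul ℝ E] :
    UniformContinuousConstSMul ℝ E :=
  uniformContinuousConstSMul_of_continuousConstSMul ℝ E

/-! `E` is a dense subspace of `G → ℝ` with two opposing features: it prescribes values freely on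
countable sets (`FillsCountable`), yet every linearly independent sequence in it is unbounded at
some coordinate. Such an `E` is the span of functions `e α`: since `G` has continuum many points,
each index can encode both values to be taken on a countable set and a sequence of finite
combinations of the `e α`. At coordinate `β` the sequence encoded by `β` is made unbounded; this
constrains only countably many `e α`, so enough others remain free for filling.

Filling gives density, hence the completion, and the Baire property, since nested boxes involve
countably many coordinates. Unboundedness makes `E` feral, whence quasi-completeness and `(K)`.
Filling also puts `0` in the closure of the union of the steep sets, but a null sequence there would
span a finite-dimensional space, on which the coordinates satisfy a linear relation that steepness
violates. -/

/-- Every real function agrees on any given countable set with a member of `E`. -/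
def FillsCountable {G : Type u} (E : Submodule ℝ (G → ℝ)) : Prop :=
  ∀ C : Set G, C.Countable → ∀ f : G → ℝ, ∃ e ∈ E, Set.EqOn e f C

/-! ### Construction of the subspace -/

theorem LinearIndependent.exists_linearMap_apply_eq_natCast {V : Type*} [AddCommGroup V]
    [Module ℝ V] {y : ℕ → V} (hy : LinearIndependent ℝ y) :
    ∃ φ : V →ₗ[ℝ] ℝ, ∀ n, φ (y n) = n := by
  obtain ⟨φ, hφ⟩ := LinearMap.exists_extend
    ((Finsupp.linearCombination ℝ (fun n : ℕ => (n : ℝ))).comp hy.repr)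
  refine ⟨φ, fun n => ?_⟩
  have h := LinearMap.congr_fun hφ ⟨y n, Submodule.subset_span ⟨n, rfl⟩⟩
  simpa [hy.repr_eq_single n ⟨y n, Submodule.subset_span ⟨n, rfl⟩⟩ rfl] using h

theorem exists_linearMap_unbounded {V : Type*} [AddCommGroup V] [Module ℝ V] (y : ℕ → V) :
    ∃ φ : V →ₗ[ℝ] ℝ, LinearIndependent ℝ y → ∀ n, φ (y n) = n := by
  by_cases hy : LinearIndependent ℝ y
  · obtain ⟨φ, hφ⟩ := hy.exists_linearMap_apply_eq_natCast
    exact ⟨φ, fun _ => hφ⟩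
  · exact ⟨0, fun h => absurd h hy⟩

theorem nonempty_equiv_codes (G : Type u) (hG : Cardinal.mk G = Cardinal.continuum) :
    Nonempty (G ≃ (ℕ → G) × (ℕ → ℝ) × (ℕ → G →₀ ℝ)) := by
  have : Infinite G := by
    rw [Cardinal.infinite_iff, hG]; exact Cardinal.aleph0_le_continuum
  apply Cardinal.eq.1
  simp [hG, Cardinal.mk_real, Cardinal.mk_finsupp_lift_of_infinite]

theorem exists_submodule_fillsCountable_unbounded (G : Type u)
    (hG : Cardinal.mk G = Cardinal.continuum) :
    ∃ E : Submodule ℝ (G → ℝ), FillsCountable E ∧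
      ∀ x : ℕ → E, LinearIndependent ℝ x → ∃ g, ∀ M : ℝ, ∃ n, M < (x n : G → ℝ) g := by
  classical
  have : Infinite G := by
    rw [Cardinal.infinite_iff, hG]; exact Cardinal.aleph0_le_continuum
  obtain ⟨p⟩ := nonempty_equiv_codes G hG
  choose φ hφ using fun y : ℕ → G →₀ ℝ => exists_linearMap_unbounded y
  let S : G → Set G := fun β => ⋃ n, ((p β).2.2 n).support
  have hS : ∀ β, (S β).Countable := fun β =>
    Set.countable_iUnion fun n => Finset.countable_toSet _
  -- The first branch takes precedence, so on combinations of the `α ∈ S β` evaluation at `β` is the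
  -- functional `φ` of the sequence encoded by `β`. The second branch realises the values encoded by
  -- `α`.
  let e : G → G → ℝ := fun α β =>
    if α ∈ S β then φ (p β).2.2 (Finsupp.single α 1)
    else if h : ∃ n, (p α).1 n = β then (p α).2.1 h.choose else 0
  let T : (G →₀ ℝ) →ₗ[ℝ] (G → ℝ) := Finsupp.linearCombination ℝ e
  refine ⟨LinearMap.range T, ?_, ?_⟩
  · intro C hC f
    rcases C.eq_empty_or_nonempty with rfl | hne
    · exact ⟨0, Submodule.zero_mem _, by simp⟩
    obtain ⟨c, rfl⟩ := hC.exists_eq_range hne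
    -- Uncountably many indices encode the same data; only countably many are overridden at some `c
    -- n`.
    let F : ℝ → G := fun t => p.symm (c, f ∘ c, fun _ => Finsupp.single (Classical.arbitrary G) t)
    have hF : Function.Injective F := by
      intro s t h
      have h2 := p.symm.injective h
      simp only [Prod.mk.injEq, true_and] at h2
      exact Finsupp.single_injective _ (congrFun h2 0)
    have hcount : (⋃ n, S (c n)).Countable := Set.countable_iUnion fun n => hS _
    obtain ⟨t, ht⟩ : ∃ t, F t ∉ ⋃ n, S (c n) := by
      by_contra! h
      have h3 : (Set.range F).Countable := hcount.mono (by rintro _ ⟨t, rfl⟩; exact h t)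
      have h4 : (Set.univ : Set ℝ).Countable := by
        rw [← Set.image_univ] at h3
        exact Set.countable_of_injective_of_countable_image hF.injOn h3
      exact Cardinal.not_countable_real h4
    refine ⟨e (F t), ⟨Finsupp.single (F t) 1, by simp [T]⟩, ?_⟩
    rintro _ ⟨n, rfl⟩
    have hn : F t ∉ S (c n) := fun h => ht (Set.mem_iUnion.2 ⟨n, h⟩)
    have hex : ∃ m, (p (F t)).1 m = c n := ⟨n, by simp [F]⟩
    have hch : c hex.choose = c n := by simpa [F] using hex.choose_spec
    simp only [e, if_neg hn, dif_pos hex]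
    have : (p (F t)).2.1 = f ∘ c := by simp [F]
    rw [this, Function.comp_apply, hch]
  · intro x hx
    choose y hy using fun n => (x n).2
    have hyi : LinearIndependent ℝ y := by
      have h1 : LinearIndependent ℝ (fun n => (x n : G → ℝ)) :=
        hx.map' (LinearMap.range T).subtype (Submodule.ker_subtype _)
      refine LinearIndependent.of_comp T ?_
      convert h1 using 2 with n
      exact hy n
    let β : G := p.symm (Classical.arbitrary _, 0, y)
    have hβ : (p β).2.2 = y := by simp [β]
    refine ⟨β, fun M => ?_⟩
    obtain ⟨n, hn⟩ := exists_nat_gt M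
    refine ⟨n, ?_⟩
    have key : (x n : G → ℝ) β = φ y (y n) := by
      rw [← hy n]
      conv_rhs => rw [← (y n).sum_single]
      simp only [T, Finsupp.linearCombination_apply, Finsupp.sum, map_sum, Finset.sum_apply,
        Pi.smul_apply]
      refine Finset.sum_congr rfl fun α hα => ?_
      have hαS : α ∈ S β := Set.mem_iUnion.2 ⟨n, by rw [hβ]; exact hα⟩
      have : Finsupp.single α (y n α) = y n α • Finsupp.single α (1 : ℝ) := by simp
      rw [this, map_smul]
      simp only [e, if_pos hαS, hβ]
    rw [key, hφ y hyi n]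
    exact hn

/-! ### The full product and the completion -/

theorem isKappaFrechetUrysohn_pi (G : Type*) : IsKappaFrechetUrysohn (G → ℝ) := by
  classical
  intro U hU x hx
  have step : ∀ (F : Finset G) (n : ℕ), ∃ (v : G → ℝ) (S : Finset G),
      (∀ w : G → ℝ, (∀ g ∈ S, w g = v g) → w ∈ U) ∧ ∀ g ∈ F, |v g - x g| < 1 / ((n : ℝ) + 1) := by
    intro F n
    have hn : (0 : ℝ) < 1 / ((n : ℝ) + 1) := by positivity
    have hN : (F : Set G).pi (fun g => Metric.ball (x g) (1 / ((n : ℝ) + 1))) ∈ 𝓝 x :=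
      set_pi_mem_nhds F.finite_toSet fun g _ => Metric.ball_mem_nhds _ hn
    obtain ⟨v, hvN, hvU⟩ := mem_closure_iff_nhds.1 hx _ hN
    obtain ⟨S, t, ht, hsub⟩ := isOpen_pi_iff.1 hU v hvU
    refine ⟨v, S, fun w hw => hsub fun g hg => ?_, fun g hg => ?_⟩
    · rw [hw g hg]; exact (ht g hg).2
    · simpa [Real.dist_eq] using hvN g hg
  choose v S hS hv using step
  let F : ℕ → Finset G := fun n => Nat.rec ∅ (fun n F => F ∪ S F n) n
  have hF : ∀ n, F (n + 1) = F n ∪ S (F n) n := fun n => rfl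
  have hmono : Monotone F := monotone_nat_of_le_succ fun n => by
    rw [hF]; exact Finset.subset_union_left
  -- Membership in `U` is secured by the coordinates in `S (F n) n` alone. Each of these enters `F
  -- (n + 1)`, so it is well approximated from then on.
  let w : ℕ → G → ℝ := fun n g => if g ∈ S (F n) n then v (F n) n g else x g
  refine ⟨w, fun n => hS (F n) n _ fun g hg => by simp [w, hg], ?_⟩
  rw [tendsto_pi_nhds]
  intro g
  rcases em (∃ n, g ∈ F n) with hg | hg
  · obtain ⟨m, hm⟩ := hg
    rw [tendsto_iff_dist_tendsto_zero]
    refine squeeze_zero' (Eventually.of_forall fun _ => dist_nonneg) ?_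
      tendsto_one_div_add_atTop_nhds_zero_nat
    filter_upwards [eventually_ge_atTop m] with n hn
    by_cases h : g ∈ S (F n) n
    · simpa [w, h, Real.dist_eq] using (hv (F n) n g (hmono hn hm)).le
    · simp only [w, h, if_false, dist_self]; positivity
  · have : ∀ n, w n g = x g := fun n => by
      have : g ∉ S (F n) n := fun h => hg ⟨n + 1, by rw [hF]; exact Finset.mem_union_right _ h⟩
      simp [w, this]
    simp only [this, tendsto_const_nhds]

theorem IsKappaFrechetUrysohn.of_homeomorph {X Y : Type*} [TopologicalSpace X]
    [TopologicalSpace Y] (e : X ≃ₜ Y) (hY : IsKappaFrechetUrysohn Y) :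
    IsKappaFrechetUrysohn X := by
  intro U hU x hx
  obtain ⟨u, hu, hlim⟩ := hY (e '' U) (e.isOpenMap U hU) (e x)
    (by rw [← e.image_closure]; exact ⟨x, hx, rfl⟩)
  refine ⟨fun n => e.symm (u n), fun n => ?_, ?_⟩
  · obtain ⟨y, hy, h⟩ := hu n
    simpa [← h] using hy
  · simpa [Function.comp_def] using (e.symm.continuous.tendsto (e x)).comp hlim

/-- Completions are unique up to uniform isomorphism; the comparison map is linear on `E`, hence
everywhere by density. -/
theorem nonempty_completion_equiv_of_dense {F : Type*} [AddCommGroup F] [Module ℝ F]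
    [UniformSpace F] [IsUniformAddGroup F] [ContinuousSMul ℝ F] [CompleteSpace F] [T0Space F]
    (E : Submodule ℝ F) [IsUniformAddGroup E] (hE : Dense (E : Set F)) :
    Nonempty (UniformSpace.Completion E ≃L[ℝ] F) := by
  let pkg : AbstractCompletion E :=
    { space := F
      coe := Subtype.val
      uniformStruct := inferInstance
      complete := inferInstance
      separation := inferInstance
      isUniformInducing := isUniformEmbedding_subtype_val.isUniformInducing
      dense := by simpa [DenseRange] using hE }
  let e : UniformSpace.Completion E ≃ᵤ F := UniformSpace.Completion.cPkg.compareEquiv pkg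
  have hcoe : ∀ a : E, e (a : UniformSpace.Completion E) = a := fun a =>
    AbstractCompletion.compare_coe _ pkg a
  have hc : Continuous e := e.continuous
  refine ⟨{ e.toEquiv with
    map_add' := fun a b => ?_
    map_smul' := fun r a => ?_
    continuous_toFun := e.continuous
    continuous_invFun := e.symm.continuous }⟩
  · change e (a + b) = e a + e b
    refine UniformSpace.Completion.induction_on₂ a b
      (isClosed_eq (by fun_prop) (by fun_prop)) fun a b => ?_
    rw [← UniformSpace.Completion.coe_add, hcoe, hcoe, hcoe, Submodule.coe_add]
  · change e (r • a) = r • e a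
    refine UniformSpace.Completion.induction_on a
      (isClosed_eq (hc.comp (continuous_const_smul r)) (hc.const_smul r)) fun a => ?_
    rw [← UniformSpace.Completion.coe_smul, hcoe, hcoe, Submodule.coe_smul]

/-! ### Consequences of being feral -/

section Feral

variable {E : Type*} [AddCommGroup E] [Module ℝ E]

theorem isFeral_of_linearIndependent_not_bounded [TopologicalSpace E]
    (h : ∀ x : ℕ → E, LinearIndependent ℝ x → ¬ Bornology.IsVonNBounded ℝ (Set.range x)) :
    IsFeral E := by
  intro B hB
  obtain ⟨b, hbB, hspan, hli⟩ := exists_linearIndependent ℝ B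
  rw [← hspan]
  rcases b.finite_or_infinite with hb | hb
  · exact FiniteDimensional.span_of_finite ℝ hb
  · exfalso
    let f := hb.natEmbedding
    refine h (fun n => (f n : E)) (hli.comp f f.injective) (hB.subset ?_)
    rintro _ ⟨n, rfl⟩
    exact hbB (f n).2

theorem IsFeral.quasiCompleteSpace [UniformSpace E] [IsUniformAddGroup E] [ContinuousSMul ℝ E]
    [T2Space E] (hE : IsFeral E) : QuasiCompleteSpace ℝ E where
  quasiComplete s hs hc := by
    have := hE s hs
    intro l hl hls
    obtain ⟨x, -, hx⟩ := Submodule.complete_of_finiteDimensional (Submodule.span ℝ s) l hl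
      (hls.trans (principal_mono.2 Submodule.subset_span))
    have := hl.1
    exact ⟨x, hc.mem_of_tendsto (f := id) hx (le_principal_iff.1 hls), hx⟩

theorem HasPropertyK.of_normedSpace_complete {V : Type*} [NormedAddCommGroup V]
    [CompleteSpace V] : HasPropertyK V := by
  intro x hx
  refine ⟨hx, fun φ hφ => ?_⟩
  have hlim : Tendsto (fun n => ‖x (φ n)‖) atTop (𝓝 0) := by
    simpa using (hx.comp hφ.tendsto_atTop).norm
  obtain ⟨ψ, hψ, hψ'⟩ := extraction_forall_of_eventually
    (P := fun i n => ‖x (φ n)‖ < (1 / 2 : ℝ) ^ i)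
    fun i => hlim.eventually_lt_const (by positivity)
  have hsum : Summable fun i => x (φ (ψ i)) :=
    Summable.of_norm_bounded summable_geometric_two fun i => (hψ' i).le
  exact ⟨ψ, hψ, _, hsum.hasSum.tendsto_sum_nat⟩

/-- A null sequence is bounded, so it lives in a finite-dimensional space, where a subsequence with
geometrically small norms is summable. -/
theorem IsFeral.hasPropertyK [TopologicalSpace E] [IsTopologicalAddGroup E] [ContinuousSMul ℝ E]
    [T2Space E] (hE : IsFeral E) : HasPropertyK E := by
  intro x hx
  refine ⟨hx, fun φ hφ => ?_⟩
  let L := Submodule.span ℝ (Set.range x)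
  have : FiniteDimensional ℝ L := hE _ (hx.isVonNBounded_range ℝ)
  let e := (Module.finBasis ℝ L).equivFun.toContinuousLinearEquiv
  let y : ℕ → L := fun n => ⟨x n, Submodule.subset_span ⟨n, rfl⟩⟩
  have hy : Tendsto y atTop (𝓝 0) := tendsto_subtype_rng.2 (by simpa using hx)
  have hey : Tendsto (fun n => e (y n)) atTop (𝓝 0) := by
    simpa [Function.comp_def] using (e.continuous.tendsto 0).comp hy
  obtain ⟨ψ, hψ, s, hs⟩ := (HasPropertyK.of_normedSpace_complete _ hey).2 φ hφ
  refine ⟨ψ, hψ, (e.symm s : L), ?_⟩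
  have h := ((continuous_subtype_val.comp e.symm.continuous).tendsto s).comp hs
  refine h.congr fun N => ?_
  simp [y]

end Feral

theorem Submodule.exists_finsupp_relation {V : Type*} [AddCommGroup V] [Module ℝ V]
    (L : Submodule ℝ V) [FiniteDimensional ℝ L] (f : ℕ → V →ₗ[ℝ] ℝ) :
    ∃ a : ℕ →₀ ℝ, a ≠ 0 ∧ ∀ x ∈ L, ∑ i ∈ a.support, a i * f i x = 0 := by
  have hdep : ¬ LinearIndependent ℝ fun i => f i ∘ₗ L.subtype := fun h =>
    not_finite_iff_infinite.2 (inferInstanceAs (Infinite ℕ)) h.finite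
  rw [linearIndependent_iff] at hdep
  push Not at hdep
  obtain ⟨a, ha, ha0⟩ := hdep
  refine ⟨a, ha0, fun x hx => ?_⟩
  simpa [Finsupp.linearCombination_apply, Finsupp.sum] using LinearMap.congr_fun ha ⟨x, hx⟩

/-! ### Density and the Baire property -/

section Fills

variable {G : Type u} {E : Submodule ℝ (G → ℝ)}

theorem FillsCountable.dense (hE : FillsCountable E) : Dense (E : Set (G → ℝ)) := by
  intro x
  refine mem_closure_iff.2 fun o ho hx => ?_
  obtain ⟨F, t, ht, hsub⟩ := isOpen_pi_iff.1 ho x hx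
  obtain ⟨e, heE, he⟩ := hE F F.countable_toSet x
  exact ⟨e, hsub fun g hg => by rw [he hg]; exact (ht g hg).2, heE⟩

/-- The trace on `E` of the closed box with centre `x` and radius `ε` in the coordinates `F`. -/
def closedBox (x : E) (F : Finset G) (ε : ℝ) : Set E :=
  {y | ∀ g ∈ F, |(y : G → ℝ) g - (x : G → ℝ) g| ≤ ε}

theorem continuous_eval_coe (g : G) : Continuous fun x : E => (x : G → ℝ) g :=
  (continuous_apply g).comp continuous_subtype_val

theorem closedBox_mem_nhds (x : E) (F : Finset G) {ε : ℝ} (hε : 0 < ε) :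
    closedBox x F ε ∈ 𝓝 x := by
  have : ∀ᶠ y : E in 𝓝 x, ∀ g ∈ F, |(y : G → ℝ) g - (x : G → ℝ) g| ≤ ε := by
    refine (Filter.eventually_all_finset F).2 fun g _ => ?_
    have := (continuous_eval_coe g).tendsto x (Metric.closedBall_mem_nhds _ hε)
    filter_upwards [this] with y hy
    simpa [Real.dist_eq] using hy
  exact this

theorem exists_closedBox_subset {x : E} {U : Set E} (hU : U ∈ 𝓝 x) :
    ∃ (F : Finset G) (ε : ℝ), 0 < ε ∧ closedBox x F ε ⊆ U := by
  obtain ⟨V, hV, hVU⟩ := mem_nhds_subtype _ _ _ |>.1 hU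
  obtain ⟨o, hoV, ho, hxo⟩ := mem_nhds_iff.1 hV
  obtain ⟨F, t, ht, hsub⟩ := isOpen_pi_iff.1 ho _ hxo
  have hev : ∀ᶠ ε : ℝ in 𝓝[>] 0, ∀ g ∈ F, Metric.closedBall ((x : G → ℝ) g) ε ⊆ t g := by
    refine (Filter.eventually_all_finset F).2 fun g hg => ?_
    obtain ⟨δ, hδ, hsubδ⟩ := Metric.nhds_basis_closedBall.mem_iff.1
      ((ht g hg).1.mem_nhds (ht g hg).2)
    filter_upwards [Ioo_mem_nhdsGT hδ] with ε hε
    exact (Metric.closedBall_subset_closedBall hε.2.le).trans hsubδ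
  obtain ⟨ε, hε, hpos⟩ := (hev.and self_mem_nhdsWithin).exists
  refine ⟨F, ε, hpos, fun y hy => hVU (hoV (hsub fun g hg => hε g hg ?_))⟩
  simpa [Real.dist_eq] using hy g hg

theorem FillsCountable.nonempty_iInter_closedBox (hE : FillsCountable E) (x : ℕ → E)
    (F : ℕ → Finset G) (ε : ℕ → ℝ) (hε : ∀ n, 0 < ε n)
    (hanti : Antitone fun n => closedBox (x n) (F n) (ε n)) :
    (⋂ n, closedBox (x n) (F n) (ε n)).Nonempty := by
  have hmem : ∀ m n, m ≤ n → x n ∈ closedBox (x m) (F m) (ε m) := fun m n h =>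
    hanti h fun g _ => by simpa using (hε n).le
  have hcross : ∀ m n g, g ∈ F m → g ∈ F n →
      (x m : G → ℝ) g - ε m ≤ (x n : G → ℝ) g + ε n := by
    intro m n g hm hn
    have h1 := abs_le.1 (hmem m (max m n) (le_max_left _ _) g hm)
    have h2 := abs_le.1 (hmem n (max m n) (le_max_right _ _) g hn)
    linarith [h1.1, h2.2]
  let A : G → Set ℝ := fun g => {t | ∃ n, g ∈ F n ∧ t = (x n : G → ℝ) g - ε n}
  -- By `hcross`, the intervals imposed on a coordinate meet pairwise, so the supremum of their left
  -- endpoints lies in all of them.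
  obtain ⟨y, hyE, hy⟩ := hE (⋃ n, (F n : Set G))
    (Set.countable_iUnion fun n => (F n).countable_toSet) fun g => sSup (A g)
  refine ⟨⟨y, hyE⟩, Set.mem_iInter.2 fun n g hg => ?_⟩
  have hyg : y g = sSup (A g) := hy (Set.mem_iUnion.2 ⟨n, hg⟩)
  have hub : ∀ t ∈ A g, t ≤ (x n : G → ℝ) g + ε n := by
    rintro _ ⟨m, hm, rfl⟩
    exact hcross m n g hm hg
  have h1 : (x n : G → ℝ) g - ε n ≤ sSup (A g) := le_csSup ⟨_, hub⟩ ⟨n, hg, rfl⟩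
  have h2 : sSup (A g) ≤ (x n : G → ℝ) g + ε n := csSup_le ⟨_, n, hg, rfl⟩ hub
  rw [abs_le]
  constructor <;> simp only [hyg] <;> linarith

theorem FillsCountable.baireSpace (hE : FillsCountable E) : BaireSpace E where
  baire_property U hUo hUd := by
    rw [dense_iff_inter_open]
    rintro W hW ⟨w, hw⟩
    obtain ⟨F₀, ε₀, hε₀, hsub₀⟩ := exists_closedBox_subset (hW.mem_nhds hw)
    let Box := {s : E × Finset G × ℝ // 0 < s.2.2}
    let carrier : Box → Set E := fun s => closedBox s.1.1 s.1.2.1 s.1.2.2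
    have step : ∀ (n : ℕ) (s : Box), ∃ s' : Box, carrier s' ⊆ carrier s ∩ U n := by
      rintro n ⟨⟨x, F, ε⟩, hε⟩
      obtain ⟨x', hx', hxU⟩ := (hUd n).inter_nhds_nonempty
        (interior_mem_nhds.2 (closedBox_mem_nhds x F hε))
      obtain ⟨F', ε', hε', hsub⟩ := exists_closedBox_subset
        (inter_mem (mem_interior_iff_mem_nhds.1 hxU) ((hUo n).mem_nhds hx'))
      exact ⟨⟨⟨x', F', ε'⟩, hε'⟩, hsub⟩
    choose next hnext using step
    let s : ℕ → Box := fun n => Nat.rec ⟨⟨w, F₀, ε₀⟩, hε₀⟩ next n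
    have hs : ∀ n, carrier (s (n + 1)) ⊆ carrier (s n) ∩ U n := fun n => hnext n (s n)
    obtain ⟨y, hy⟩ := hE.nonempty_iInter_closedBox (fun n => (s n).1.1)
      (fun n => (s n).1.2.1) (fun n => (s n).1.2.2) (fun n => (s n).2)
      (antitone_nat_of_succ_le fun n => (hs n).trans Set.inter_subset_left)
    rw [Set.mem_iInter] at hy
    exact ⟨y, hsub₀ (hy 0), Set.mem_iInter.2 fun n => (hs n (hy (n + 1))).2⟩

theorem isFeral_of_exists_unbounded_coordinate
    (h : ∀ x : ℕ → E, LinearIndependent ℝ x → ∃ g, ∀ M : ℝ, ∃ n, M < (x n : G → ℝ) g) :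
    IsFeral E := by
  refine isFeral_of_linearIndependent_not_bounded fun x hx hb => ?_
  obtain ⟨g, hg⟩ := h x hx
  have := hb.image ((ContinuousLinearMap.proj g : (G → ℝ) →L[ℝ] ℝ).comp E.subtypeL)
  rw [NormedSpace.isVonNBounded_iff] at this
  obtain ⟨M, hM⟩ := this.bddAbove
  obtain ⟨n, hn⟩ := hg M
  exact hn.not_ge (hM ⟨x n, ⟨n, rfl⟩, rfl⟩)

/-! ### Failure of the `κ`-Fréchet–Urysohn property -/

/-- The vectors whose coordinates along `c` are positive and grow by a factor larger than `k` up to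
the index `k`, where they exceed `1`. -/
def steepSet (E : Submodule ℝ (G → ℝ)) (c : ℕ → G) (k : ℕ) : Set E :=
  {x | 0 < (x : G → ℝ) (c 0) ∧
    (∀ i ∈ Finset.range k, k * (x : G → ℝ) (c i) < (x : G → ℝ) (c (i + 1))) ∧
    1 < (x : G → ℝ) (c k)}

theorem isOpen_steepSet (c : ℕ → G) (k : ℕ) : IsOpen (steepSet E c k) := by
  have h := fun i => continuous_eval_coe (E := E) (c i)
  have hstep : IsOpen {x : E | ∀ i ∈ Finset.range k,
      k * (x : G → ℝ) (c i) < (x : G → ℝ) (c (i + 1))} := by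
    have : {x : E | ∀ i ∈ Finset.range k, k * (x : G → ℝ) (c i) < (x : G → ℝ) (c (i + 1))} =
        ⋂ i ∈ Finset.range k, {x : E | k * (x : G → ℝ) (c i) < (x : G → ℝ) (c (i + 1))} := by
      ext x
      simp
    rw [this]
    exact isOpen_biInter_finset fun i _ => isOpen_lt (continuous_const.mul (h i)) (h (i + 1))
  exact (isOpen_lt continuous_const (h 0)).inter
    (hstep.inter (isOpen_lt continuous_const (h k)))

theorem pos_of_mem_steepSet {c : ℕ → G} {k : ℕ} {x : E} (hx : x ∈ steepSet E c k)
    (hk : 1 ≤ k) {i : ℕ} (hi : i ≤ k) : 0 < (x : G → ℝ) (c i) := by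
  obtain ⟨h0, hstep, -⟩ := hx
  have hk' : (1 : ℝ) ≤ k := by exact_mod_cast hk
  induction i with
  | zero => exact h0
  | succ i ih =>
    have := ih (by omega)
    have := hstep i (Finset.mem_range.2 (by omega))
    nlinarith

theorem mul_lt_of_mem_steepSet {c : ℕ → G} {k : ℕ} {x : E} (hx : x ∈ steepSet E c k)
    (hk : 1 ≤ k) {i j : ℕ} (hij : i < j) (hj : j ≤ k) :
    k * (x : G → ℝ) (c i) < (x : G → ℝ) (c j) := by
  have hk' : (1 : ℝ) ≤ k := by exact_mod_cast hk
  induction j, hij using Nat.le_induction with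
  | base => exact hx.2.1 i (Finset.mem_range.2 (by omega))
  | succ j hij ih =>
    have h1 := ih (by omega)
    have h2 := hx.2.1 j (Finset.mem_range.2 (by omega))
    have h3 := pos_of_mem_steepSet hx hk (i := j) (by omega)
    nlinarith

theorem FillsCountable.zero_mem_closure_iUnion_steepSet (hE : FillsCountable E) {c : ℕ → G}
    (hc : Function.Injective c) : (0 : E) ∈ closure (⋃ k, steepSet E c k) := by
  rw [mem_closure_iff_nhds]
  intro V hV
  obtain ⟨F, ε, hε, hsub⟩ := exists_closedBox_subset hV
  obtain ⟨k, hk⟩ : ∃ k, ∀ i, c i ∈ F → i < k := by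
    have hfin : {i | c i ∈ F}.Finite := F.finite_toSet.preimage hc.injOn
    obtain ⟨k, hk⟩ := hfin.bddAbove
    exact ⟨k + 1, fun i hi => Nat.lt_succ_of_le (hk hi)⟩
  obtain ⟨t, ht0, ht1, htk, htε⟩ : ∃ t : ℝ, 0 < t ∧ t ≤ 1 ∧ k * t < 1 ∧ 2 * t ≤ ε := by
    refine ⟨min (1 / (k + 1)) (ε / 2), by positivity, ?_, ?_, ?_⟩
    · refine (min_le_left _ _).trans ?_
      rw [div_le_one (by positivity)]
      linarith [k.cast_nonneg (α := ℝ)]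
    · refine (mul_le_mul_of_nonneg_left (min_le_left _ _) k.cast_nonneg).trans_lt ?_
      rw [mul_one_div, div_lt_one (by positivity)]
      linarith
    · linarith [min_le_right (1 / ((k : ℝ) + 1)) (ε / 2)]
  -- The growth factor is `1 / t > k` and the value at `c k` is `2`. The points `c i` in `F` have `i
  -- < k`, so their values are at most `2 * t ≤ ε`.
  let f : G → ℝ := Function.extend c (fun i => 2 * t ^ (k - i)) 0
  have hf : ∀ i, f (c i) = 2 * t ^ (k - i) := fun i => hc.extend_apply _ _ i
  obtain ⟨y, hyE, hy⟩ := hE (Set.range c ∪ F)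
    ((Set.countable_range c).union F.countable_toSet) f
  have hyc : ∀ i, y (c i) = 2 * t ^ (k - i) := fun i => by rw [hy (Or.inl ⟨i, rfl⟩), hf]
  refine ⟨⟨y, hyE⟩, hsub fun g hg => ?_, Set.mem_iUnion.2 ⟨k, ?_, fun i hi => ?_, ?_⟩⟩
  · simp only [Submodule.coe_zero, Pi.zero_apply, sub_zero]
    by_cases h : ∃ i, c i = g
    · obtain ⟨i, rfl⟩ := h
      have hi := hk i hg
      rw [hyc, abs_of_pos (by positivity)]
      have : t ^ (k - i) ≤ t := pow_le_of_le_one ht0.le ht1 (by omega)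
      linarith
    · have hfg : f g = 0 := Function.extend_apply' _ _ _ h
      rw [hy (Or.inr hg), hfg, abs_zero]
      exact hε.le
  · simp only [hyc]; positivity
  · rw [Finset.mem_range] at hi
    simp only [hyc]
    have : k - i = (k - (i + 1)) + 1 := by omega
    rw [this, pow_succ]
    have hp : 0 < t ^ (k - (i + 1)) := by positivity
    nlinarith
  · simp [hyc]

theorem not_tendsto_zero_of_mem_steepSet (hE : IsFeral E) {c : ℕ → G} {u : ℕ → E} {k : ℕ → ℕ}
    (hu : ∀ n, u n ∈ steepSet E c (k n)) : ¬ Tendsto u atTop (𝓝 0) := by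
  intro hlim
  -- The coordinate at `c (k n)` exceeds `1`, while each fixed coordinate tends to `0`.
  have hk : ∀ K, ∀ᶠ n in atTop, K < k n := by
    intro K
    have : ∀ᶠ n in atTop, ∀ j ∈ Finset.range (K + 1), (u n : G → ℝ) (c j) < 1 := by
      refine (Filter.eventually_all_finset _).2 fun j _ => ?_
      have h := ((continuous_eval_coe (E := E) (c j)).tendsto 0).comp hlim
      exact h.eventually_lt_const (by simp)
    filter_upwards [this] with n hn
    by_contra! h
    exact (hn (k n) (Finset.mem_range.2 (by omega))).not_gt (hu n).2.2
  obtain ⟨L, hL, huL⟩ : ∃ L : Submodule ℝ E, FiniteDimensional ℝ L ∧ ∀ n, u n ∈ L :=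
    ⟨_, hE _ (hlim.isVonNBounded_range ℝ), fun n => Submodule.subset_span ⟨n, rfl⟩⟩
  obtain ⟨a, ha0, ha⟩ := L.exists_finsupp_relation fun i =>
    (LinearMap.proj (c i) : (G → ℝ) →ₗ[ℝ] ℝ) ∘ₗ E.subtype
  have hne : a.support.Nonempty := Finsupp.support_nonempty_iff.2 ha0
  let m := a.support.max' hne
  have hm : m ∈ a.support := a.support.max'_mem hne
  have ham : 0 < |a m| := abs_pos.2 (Finsupp.mem_support_iff.1 hm)
  let A := ∑ i ∈ a.support.erase m, |a i|
  -- For `k n > A / |a m|` the term of top index `m` outweighs all the others, so the relation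
  -- cannot hold.
  obtain ⟨K, hK⟩ := exists_nat_gt (A / |a m|)
  obtain ⟨n, hn⟩ := (hk (K + m + 1)).exists
  let x : G → ℝ := u n
  have hrel : ∑ i ∈ a.support, a i * x (c i) = 0 := by
    simpa [x] using ha (u n) (huL n)
  have hlt : ∀ i < m, k n * x (c i) < x (c m) := fun i hi =>
    mul_lt_of_mem_steepSet (hu n) (by omega) hi (by omega)
  have hpos : ∀ i ≤ m, 0 < x (c i) := fun i hi => pos_of_mem_steepSet (hu n) (by omega) (by omega)
  rw [← Finset.add_sum_erase _ _ hm] at hrel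
  have hle : |a m| * x (c m) ≤ ∑ i ∈ a.support.erase m, |a i| * x (c i) := by
    have him : ∀ i ∈ a.support, i ≤ m := fun i hi => a.support.le_max' i hi
    calc |a m| * x (c m) = |∑ i ∈ a.support.erase m, a i * x (c i)| := by
          rw [← abs_of_pos (hpos m le_rfl), ← abs_mul, eq_neg_of_add_eq_zero_left hrel, abs_neg]
      _ ≤ ∑ i ∈ a.support.erase m, |a i * x (c i)| := Finset.abs_sum_le_sum_abs _ _
      _ = _ := Finset.sum_congr rfl fun i hi => by
          rw [abs_mul, abs_of_pos (hpos i (him i (Finset.mem_of_mem_erase hi)))]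
  have hle' : k n * ∑ i ∈ a.support.erase m, |a i| * x (c i) ≤ A * x (c m) := by
    rw [Finset.mul_sum, Finset.sum_mul]
    refine Finset.sum_le_sum fun i hi => ?_
    have him : i < m := lt_of_le_of_ne (a.support.le_max' i (Finset.mem_of_mem_erase hi))
      (Finset.ne_of_mem_erase hi)
    rw [mul_left_comm]
    exact mul_le_mul_of_nonneg_left (hlt i him).le (abs_nonneg _)
  have hkA : k n * |a m| ≤ A := by
    refine le_of_mul_le_mul_right ?_ (hpos m le_rfl)
    rw [mul_assoc]
    exact (mul_le_mul_of_nonneg_left hle (k n).cast_nonneg).trans hle'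
  rw [div_lt_iff₀ ham] at hK
  have hKk : (K : ℝ) ≤ k n := by exact_mod_cast (by omega : K ≤ k n)
  nlinarith

theorem FillsCountable.not_isKappaFrechetUrysohn [Infinite G] (hfill : FillsCountable E)
    (hE : IsFeral E) : ¬ IsKappaFrechetUrysohn E := by
  intro h
  let c := Infinite.natEmbedding G
  obtain ⟨u, hu, hlim⟩ := h _ (isOpen_iUnion fun k => isOpen_steepSet (E := E) c k) 0
    (hfill.zero_mem_closure_iUnion_steepSet c.injective)
  choose k hk using fun n => Set.mem_iUnion.1 (hu n)
  exact not_tendsto_zero_of_mem_steepSet hE hk hlim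

end Fills

theorem mainTheorem5 (G : Type u) (hG : Cardinal.mk G = Cardinal.continuum) :
    ∃ (E : Type u) (_ : AddCommGroup E) (_ : Module ℝ E) (_ : UniformSpace E)
      (_ : IsUniformAddGroup E) (_ : ContinuousSMul ℝ E) (_ : LocallyConvexSpace ℝ E)
      (_ : T2Space E),
      BaireSpace E ∧
      IsFeral E ∧
      QuasiCompleteSpace ℝ E ∧
      HasPropertyK E ∧
      ¬ IsKappaFrechetUrysohn E ∧
      Nonempty (UniformSpace.Completion E ≃L[ℝ] (G → ℝ)) ∧
      IsKappaFrechetUrysohn (UniformSpace.Completion E) := by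
  have : Infinite G := by
    rw [Cardinal.infinite_iff, hG]; exact Cardinal.aleph0_le_continuum
  obtain ⟨E, hfill, hunb⟩ := exists_submodule_fillsCountable_unbounded G hG
  have hferal : IsFeral E := isFeral_of_exists_unbounded_coordinate hunb
  have hE : IsUniformAddGroup E := inferInstanceAs (IsUniformAddGroup E.toAddSubgroup)
  obtain ⟨e⟩ := nonempty_completion_equiv_of_dense E hfill.dense
  exact ⟨E, inferInstance, inferInstance, inferInstance, hE, inferInstance, inferInstance,
    inferInstance, hfill.baireSpace, hferal, hferal.quasiCompleteSpace, hferal.hasPropertyK,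
    hfill.not_isKappaFrechetUrysohn hferal, ⟨e⟩,
    (isKappaFrechetUrysohn_pi G).of_homeomorph e.toHomeomorph⟩
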